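/- **Setting.** Finitely many pursuers move in the plane, with a stationary target $T$. Pursuer $i$ has constant speed $V_i>0$ and kinematics $\dot x_i=V_i\cos\gamma_i$, $\dot y_i=V_i\sin\gamma_i$, $\dot\gamma_i=a_i/V_i$. Let $R_i$ be its distance to $T$ and $\theta_i\in(-\pi,\pi]$ its lead angle, i.e. the signed angle from its heading to its line of sight to $T$. Put $$\tilde t_i=\frac{R_i\theta_i}{V_i\sin\theta_i},\qquad a_i'=\frac{2V_i^2\sin\theta_i}{R_i}.$$ The pursuers communicate over a switching digraph $\mathcal G(t)=(\mathcal V(t),\mathcal E(t))$, which is static between switching instants, of which there are finitely many in bounded time. Pursuer $i$ belongs to $\mathcal V(t)$ exactly during an interval $[\alpha_i,\beta_i)$ with $0\le\alpha_i<\beta_i\le\infty$; it is *added* at time $\alpha_i$ if $\alpha_i>0$, and *removed* at time $\beta_i$ if $\beta_i<\infty$. Some pursuer has $\alpha_i=0$. Each pursuer starts (at time $\alpha_i$) with $R_i>0$ and $\theta_i\notin\{0,\pi\}$. *Guidance law.* As long as no pursuer of the network has reached $T$, at almost every time each $i\in\mathcal V(t)$ uses $a_i=0$ if $\tilde t_i<\tilde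 t_j$ for some out-neighbour $j$, and $a_i=a_i'$ if $\tilde t_i\ge\tilde t_j$ for all out-neighbours $j$. In the second case sliding is also admitted: if a chain of successive out-neighbours starting at $i$ leads, through pursuers whose estimates all equal $\tilde t_i$, to one with a strictly larger estimate, then $a_i$ may be any average $w\,a_i'$, $w\in[0,1]$ (infinitely fast switching between the two inputs). A *leader* of a graph is a node with the largest $\tilde t_i$ among its nodes; a node is *globally reachable* if there is a directed path to it from every other node. "The leader is globally reachable" means that some leader is. Let $t_m$ denote the instants at which the leader of $\mathcal G(t)$ loses global reachability (including $t=0$ if it is not globally reachable initially), and let $[t_m,t_m+\delta_m)$ be the maximal period starting at $t_m$ during which it is not globally reachable. **Statement.** Suppose that the following hold at all times before any pursuer of the network reaches $T$. 0. For every $m$ the leader is globally reachable again at some finite time $t_m+\delta_m$, where $\delta_m<\min_{i\in\mathcal V(t_m)}\tilde t_i(t_m)$. 1. Whenever a node is removed, the leader of the resulting graph is globally reachable. 2. Let a node $b$ be added at time $t$, and let $\mathcal G^-$ be the graph to which it is added (the subgraph of $\mathcal G(t)$ on the nodes that are not added at time $t$). If the leader of $\mathcal G^-$ is globally reachable in $\mathcal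 G^-$, then $b$ has an out-neighbour in $\mathcal G^-$ if $b$ is not a leader of the resulting graph $\mathcal G(t)$, and $b$ is globally reachable in $\mathcal G(t)$ if it is. 3. If a node $c$ is added at time $t_a$ with $t_m\le t_a\le t_m+\delta_m$, then $t_a+\tilde t_c(t_a)>t_m+\delta_m$. Then the target is intercepted simultaneously: there is a finite time $t_f>0$ such that no pursuer, while in the network, reaches $T$ before $t_f$; the network is not empty just before $t_f$; and every pursuer that belongs to the network just before $t_f$ is at $T$ at time $t_f$, with $\tilde t_i(t)\to0$ as $t\uparrow t_f$. -/

import Mathlib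

open Set Filter Topology MeasureTheory

noncomputable section

/-- A switching digraph with changing nodes.  `ι` labels all nodes that ever take part; node `i`
belongs to the graph during `[join i, leave i)`.  A node with `join i = 0` is there from the start,
a node with `join i > 0` is added at time `join i`, and `leave i = ⊤` means that it is never
removed.  The edges switch at instants of which there are finitely many in bounded time, and the
graph is static between them.  Self-loops are allowed and play no role below. -/
structure SwitchingDigraph (ι : Type*) where
  join : ι → ℝ
  leave : ι → WithTop ℝ
  join_nonneg : ∀ i, 0 ≤ join i
  join_lt_leave : ∀ i, (join i : WithTop ℝ) < leave i
  graph : ℝ → Digraph ι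
  present_of_adj : ∀ t i j, (graph t).Adj i j →
    (join i ≤ t ∧ (t : WithTop ℝ) < leave i) ∧ (join j ≤ t ∧ (t : WithTop ℝ) < leave j)
  switches : Set ℝ
  switches_finite : ∀ T : ℝ, (switches ∩ Icc 0 T).Finite
  static_between : ∀ s t : ℝ, 0 ≤ s → s ≤ t → (∀ u ∈ Ioc s t, u ∉ switches) → graph s = graph t

/-- The pursuers, their communication graph, a stationary target at `(xT, yT)`, constant speeds
`V i`, positions `(x i, y i)`, heading angles `γ i` and lateral accelerations `a i` as functions of
time (they matter only while the pursuer is in flight). -/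
structure Engagement (ι : Type*) extends SwitchingDigraph ι where
  xT : ℝ
  yT : ℝ
  V : ι → ℝ
  V_pos : ∀ i, 0 < V i
  x : ι → ℝ → ℝ
  y : ι → ℝ → ℝ
  γ : ι → ℝ → ℝ
  a : ι → ℝ → ℝ

namespace Engagement

variable {ι : Type*} (E : Engagement ι)

/-- The node set `𝒱(t)`. -/
def nodes (t : ℝ) : Set ι := {i | E.join i ≤ t ∧ (t : WithTop ℝ) < E.leave i}

/-- The nodes of `𝒱(t)` that are not added at time `t` itself. -/
def oldNodes (t : ℝ) : Set ι := {i | i ∈ E.nodes t ∧ E.join i < t}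

/-- The closed period from joining to removal. -/
def InFlight (i : ι) (t : ℝ) : Prop := E.join i ≤ t ∧ (t : WithTop ℝ) ≤ E.leave i

/-- The vector from pursuer `i` to the target. -/
def los (i : ι) (t : ℝ) : ℂ := ⟨E.xT - E.x i t, E.yT - E.y i t⟩

/-- The distance `R_i` from pursuer `i` to the target. -/
def R (i : ι) (t : ℝ) : ℝ := ‖E.los i t‖

/-- The lead angle `θ_i ∈ (-π, π]`: the signed angle from the heading direction of pursuer `i` to
its line of sight to the target. -/
def θ (i : ι) (t : ℝ) : ℝ :=
  Complex.arg (E.los i t * Complex.exp (-((E.γ i t : ℂ) * Complex.I)))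

/-- The lateral acceleration `a_i'` of the circular path to the target. -/
def aCirc (i : ι) (t : ℝ) : ℝ := 2 * E.V i ^ 2 * Real.sin (E.θ i t) / E.R i t

/-- The estimated time of interception `t̃_i`. -/
def tEst (i : ι) (t : ℝ) : ℝ := E.R i t * E.θ i t / (E.V i * Real.sin (E.θ i t))

/-- No pursuer of the network has reached the target up to and including time `t`. -/
def Engaged (t : ℝ) : Prop :=
  0 ≤ t ∧ ∀ s, 0 ≤ s → s ≤ t → ∀ i, E.InFlight i s → 0 < E.R i s

/-- Unicycle kinematics `ẋ = V cos γ`, `ẏ = V sin γ`, `γ̇ = a / V` (in integrated form) as long as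
the target has not been reached. -/
structure Kinematics : Prop where
  continuousOn_x : ∀ i, ContinuousOn (E.x i) {t | E.InFlight i t}
  continuousOn_y : ∀ i, ContinuousOn (E.y i) {t | E.InFlight i t}
  integrable_a : ∀ i t, E.Engaged t → E.InFlight i t →
    IntervalIntegrable (E.a i) volume (E.join i) t
  x_eq : ∀ i t, E.Engaged t → E.InFlight i t →
    E.x i t = E.x i (E.join i) + ∫ s in (E.join i)..t, E.V i * Real.cos (E.γ i s)
  y_eq : ∀ i t, E.Engaged t → E.InFlight i t →
    E.y i t = E.y i (E.join i) + ∫ s in (E.join i)..t, E.V i * Real.sin (E.γ i s)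
  γ_eq : ∀ i t, E.Engaged t → E.InFlight i t →
    E.γ i t = E.γ i (E.join i) + ∫ s in (E.join i)..t, E.a i s / E.V i

/-- Every pursuer starts away from the target, with lead angle different from `0` and `π`. -/
def AdmissibleStart : Prop :=
  ∀ i, 0 < E.R i (E.join i) ∧ E.θ i (E.join i) ≠ 0 ∧ E.θ i (E.join i) ≠ Real.pi

/-- Pursuer `i` has an out-neighbour with larger estimate, directly or through a chain of
out-neighbours whose estimates are all equal to that of `i`. -/
inductive Delayed (t : ℝ) : ι → Prop
  | larger {i j : ι} : (E.graph t).Adj i j → E.tEst i t < E.tEst j t → Delayed t i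
  | tied {i j : ι} : (E.graph t).Adj i j → E.tEst i t = E.tEst j t → Delayed t j → Delayed t i

/-- The guidance law at time `t`: `a_i = 0` if some out-neighbour has a larger estimate, and
`a_i = a_i'` otherwise.  The last alternative admits sliding: a pursuer that keeps level with an
out-neighbour which is itself being delayed switches infinitely fast between the two inputs, and
its effective input is an average of `0` and `a_i'`.  Every motion that obeys the law without
sliding is included. -/
def LawAt (i : ι) (t : ℝ) : Prop :=
  ((∃ j, (E.graph t).Adj i j ∧ E.tEst i t < E.tEst j t) → E.a i t = 0) ∧
  ((∀ j, (E.graph t).Adj i j → E.tEst j t ≤ E.tEst i t) →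
    E.a i t = E.aCirc i t ∨
      (E.Delayed t i ∧ ∃ w ∈ Icc (0 : ℝ) 1, E.a i t = w * E.aCirc i t))

/-- The pursuers obey the guidance law at almost every time before the target is reached. -/
def FollowsGuidanceLaw : Prop :=
  ∀ i, ∀ᵐ t ∂(volume : Measure ℝ), E.Engaged t → i ∈ E.nodes t → E.LawAt i t

/-- `l` has the largest estimate among the nodes in `W`. -/
def IsLeader (W : Set ι) (t : ℝ) (l : ι) : Prop :=
  l ∈ W ∧ ∀ j ∈ W, E.tEst j t ≤ E.tEst l t

/-- In the subgraph of `𝒢(t)` induced on `W`, there is a directed path from every node to `l`. -/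
def GloballyReachable (W : Set ι) (t : ℝ) (l : ι) : Prop :=
  l ∈ W ∧ ∀ j ∈ W,
    Relation.ReflTransGen (fun p q => p ∈ W ∧ q ∈ W ∧ (E.graph t).Adj p q) j l

/-- The subgraph of `𝒢(t)` induced on `W` has a globally reachable leader. -/
def LeaderReachable (W : Set ι) (t : ℝ) : Prop :=
  ∃ l, E.IsLeader W t l ∧ E.GloballyReachable W t l

/-- `𝒢(t)` has a globally reachable leader, that is, it is of the form `𝒢ᶜ(t)`. -/
def Connected (t : ℝ) : Prop := E.LeaderReachable (E.nodes t) t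

/-- `tm` is an instant at which the leader loses global reachability (or the initial time, if the
leader is not globally reachable initially). -/
def LosesReachability (tm : ℝ) : Prop :=
  0 ≤ tm ∧ ¬ E.Connected tm ∧ (tm = 0 ∨ ∀ᶠ t in 𝓝[<] tm, E.Connected t)

/-- `[tm, tm + δ)` is a maximal period during which the leader is not globally reachable. -/
def DisconnectedPhase (tm δ : ℝ) : Prop :=
  E.LosesReachability tm ∧ 0 < δ ∧ (∀ t ∈ Ico tm (tm + δ), ¬ E.Connected t) ∧
    E.Connected (tm + δ)

/-- Whenever the leader loses global reachability, it is globally reachable again after a time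
`δ_m < min_{i ∈ 𝒱} t̃_i(t_m)`. -/
def DisconnectionBound : Prop :=
  ∀ tm, E.Engaged tm → E.LosesReachability tm →
    ∃ δ, E.DisconnectedPhase tm δ ∧ ∀ i ∈ E.nodes tm, δ < E.tEst i tm

/-- After the removal of a node, the leader of the resulting graph is globally reachable. -/
def RemovalCondition : Prop :=
  ∀ (i : ι) (t : ℝ), E.leave i = (t : WithTop ℝ) → E.Engaged t → E.Connected t

/-- A node `b` added to a graph with globally reachable leader has an out-neighbour in that graph
if it is not the leader of the resulting graph, and is globally reachable if it is. -/
def ConnectedAdditionCondition : Prop :=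
  ∀ b : ι, 0 < E.join b → E.Engaged (E.join b) →
    E.LeaderReachable (E.oldNodes (E.join b)) (E.join b) →
      (¬ E.IsLeader (E.nodes (E.join b)) (E.join b) b →
        ∃ j ∈ E.oldNodes (E.join b), (E.graph (E.join b)).Adj b j) ∧
      (E.IsLeader (E.nodes (E.join b)) (E.join b) b →
        E.GloballyReachable (E.nodes (E.join b)) (E.join b) b)

/-- A node `c` added at `t_a ∈ [t_m, t_m + δ_m]` satisfies `t_a + t̃_c(t_a) > t_m + δ_m`. -/
def DisconnectedAdditionCondition : Prop :=
  ∀ tm δ : ℝ, E.DisconnectedPhase tm δ → ∀ c : ι, 0 < E.join c → E.Engaged (E.join c) →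
    E.join c ∈ Icc tm (tm + δ) → tm + δ < E.join c + E.tEst c (E.join c)

/-- At some finite time `tf > 0` all pursuers of the network reach the target together: nobody
reaches it earlier, the network is not empty just before `tf`, and all pursuers that belong to it
just before `tf` are at the target at time `tf`, their estimates having converged to the common
value `0`. -/
def SimultaneousInterception : Prop :=
  ∃ tf : ℝ, 0 < tf ∧
    (∀ t, 0 ≤ t → t < tf → ∀ i, E.InFlight i t → ¬ (E.x i t = E.xT ∧ E.y i t = E.yT)) ∧
    (∃ i, E.join i < tf ∧ (tf : WithTop ℝ) ≤ E.leave i) ∧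
    ∀ i, E.join i < tf → (tf : WithTop ℝ) ≤ E.leave i →
      (E.x i tf = E.xT ∧ E.y i tf = E.yT) ∧ Tendsto (E.tEst i) (𝓝[<] tf) (𝓝 0)

end Engagement

end

/-! Write `z = R e^{iθ}` for the line of sight in the heading frame (`rel`). The estimate `t̃` is
the flight time along the circular arc that is tangent to the heading and ends at the target, and `t
+ t̃` is the predicted arrival time. With input `w a'`, `0 ≤ w ≤ 1`, its derivative is `2 (1 - w) (1
- θ cot θ) ≥ 0` (`tEst_hasDerivAt`). So predictions never decrease, and a leader's, where `w = 1`,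
is stationary. While the node set is constant the largest prediction is therefore constant. Since
nodes eventually stop changing, somebody arrives in finite time. Let `tf` be the first arrival, by
pursuer `j`.

Nobody arrives before a time once predicted (`add_tEst_le_arrival`), so all predictions of `j` are
at most `tf`. Disconnection cannot last up to `tf`, because the bounds on its length would make `j`
predict a time after `tf`. Hence there are connected instants on the final static stretch before
`tf`. If some pursuer predicted a time after `tf`, a leader would too, and a path from `j` to it
would contain an edge `p → q` with `q` late and `p` never late. Then `p` is forced onto the target
at `tf`, because `R ≤ V t̃ ≤ V (tf - t)`. But the larger estimate of `q` eventually makes `p` fly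
straight, with `θ ∉ {0, π}`, so it misses. This contradiction gives `t + t̃ ≤ tf` for all, and the
same squeeze brings everyone to the target (`add_tEst_le_of_arrival`). -/

/-! ### Calculus of absolutely continuous functions. -/

namespace AbsolutelyContinuousOnInterval

/-- A Lipschitz function of an absolutely continuous function is absolutely continuous. -/
theorem lipschitzOnWith_comp {X Y : Type*} [PseudoMetricSpace X] [PseudoMetricSpace Y]
    {f : ℝ → X} {φ : X → Y} {a b : ℝ} {K : NNReal} (hf : AbsolutelyContinuousOnInterval f a b)
    (hφ : LipschitzOnWith K φ (f '' uIcc a b)) :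
    AbsolutelyContinuousOnInterval (fun t => φ (f t)) a b := by
  rw [absolutelyContinuousOnInterval_iff] at hf ⊢
  intro ε hε
  obtain ⟨δ, hδ, h⟩ := hf (ε / (K + 1)) (by positivity)
  refine ⟨δ, hδ, fun E hE hlen => ?_⟩
  have h1 := h E hE hlen
  have h2 : ∑ i ∈ Finset.range E.1, dist (φ (f (E.2 i).1)) (φ (f (E.2 i).2)) ≤
      K * ∑ i ∈ Finset.range E.1, dist (f (E.2 i).1) (f (E.2 i).2) := by
    rw [Finset.mul_sum]
    refine Finset.sum_le_sum fun i hi => ?_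
    exact hφ.dist_le_mul _ (mem_image_of_mem _ (hE.1 i hi).1) _ (mem_image_of_mem _ (hE.1 i hi).2)
  have hs : 0 ≤ ∑ i ∈ Finset.range E.1, dist (f (E.2 i).1) (f (E.2 i).2) :=
    Finset.sum_nonneg fun _ _ => dist_nonneg
  rw [lt_div_iff₀ (by positivity)] at h1
  nlinarith

/-- A `C¹` function of an absolutely continuous function is absolutely continuous. -/
theorem contDiffAt_comp {X Y : Type*} [NormedAddCommGroup X] [NormedSpace ℝ X]
    [NormedAddCommGroup Y] [NormedSpace ℝ Y]
    {f : ℝ → X} {φ : X → Y} {a b : ℝ} (hf : AbsolutelyContinuousOnInterval f a b)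
    (hφ : ∀ t ∈ uIcc a b, ContDiffAt ℝ 1 φ (f t)) :
    AbsolutelyContinuousOnInterval (fun t => φ (f t)) a b := by
  have hc : IsCompact (f '' uIcc a b) := isCompact_uIcc.image_of_continuousOn hf.continuousOn
  have hl : LocallyLipschitzOn (f '' uIcc a b) φ := by
    rintro _ ⟨t, ht, rfl⟩
    obtain ⟨K, s, hs, hK⟩ := (hφ t ht).exists_lipschitzOnWith
    exact ⟨K, s, mem_nhdsWithin_of_mem_nhds hs, hK⟩
  obtain ⟨K, hK⟩ := hl.exists_lipschitzOnWith_of_compact hc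
  exact hf.lipschitzOnWith_comp hK

theorem sup {f g : ℝ → ℝ} {a b : ℝ} (hf : AbsolutelyContinuousOnInterval f a b)
    (hg : AbsolutelyContinuousOnInterval g a b) :
    AbsolutelyContinuousOnInterval (f ⊔ g) a b := by
  refine squeeze_zero (fun t => Finset.sum_nonneg fun i _ => dist_nonneg) (fun t => ?_)
    (by simpa using Tendsto.add hf hg)
  rw [← Finset.sum_add_distrib]
  refine Finset.sum_le_sum fun i _ => ?_
  simp only [Real.dist_eq, Pi.sup_apply]
  exact (abs_max_sub_max_le_max _ _ _ _).trans
    (max_le_add_of_nonneg (abs_nonneg _) (abs_nonneg _))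

theorem le_of_ae_hasDerivAt_nonneg {f : ℝ → ℝ} {a b : ℝ} (hab : a ≤ b)
    (hf : AbsolutelyContinuousOnInterval f a b)
    (h : ∀ᵐ t, t ∈ Ioo a b → ∃ d, 0 ≤ d ∧ HasDerivAt f d t) : f a ≤ f b := by
  have h1 := hf.integral_deriv_eq_sub
  have h2 : 0 ≤ ∫ t in a..b, deriv f t := by
    refine intervalIntegral.integral_nonneg_of_ae_restrict hab ?_
    rw [EventuallyLE, ae_restrict_iff' measurableSet_Icc]
    have ha : ∀ᵐ t : ℝ, t ≠ a := by simp [ae_iff, measure_singleton]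
    have hb : ∀ᵐ t : ℝ, t ≠ b := by simp [ae_iff, measure_singleton]
    filter_upwards [h, ha, hb] with t ht hta htb hmem
    obtain ⟨d, hd, hd'⟩ := ht ⟨lt_of_le_of_ne hmem.1 hta.symm, lt_of_le_of_ne hmem.2 htb⟩
    simpa [hd'.deriv] using hd
  linarith

theorem eq_of_ae_hasDerivAt_zero {f : ℝ → ℝ} {a b : ℝ} (hab : a ≤ b)
    (hf : AbsolutelyContinuousOnInterval f a b)
    (h : ∀ᵐ t, t ∈ Ioo a b → HasDerivAt f 0 t) : f a = f b := by
  refine le_antisymm (le_of_ae_hasDerivAt_nonneg hab hf ?_) ?_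
  · filter_upwards [h] with t ht hm using ⟨0, le_rfl, ht hm⟩
  · have := le_of_ae_hasDerivAt_nonneg hab hf.neg (by
      filter_upwards [h] with t ht hm using ⟨0, le_rfl, by simpa using (ht hm).neg⟩)
    simpa using this

end AbsolutelyContinuousOnInterval

/-! ### Inequalities between an angle and its sine. -/

/-- This is `θ cot θ ≤ 1`, which fixes the sign of the derivative of the predicted time. -/
theorem Complex.arg_mul_re_le_im_mul {z : ℂ} (hz : z.im ≠ 0) : z.arg * z.re / z.im ≤ 1 := by
  have hz0 : z ≠ 0 := fun h => hz (by simp [h])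
  have hn : 0 < ‖z‖ := norm_pos_iff.2 hz0
  have key : ∀ θ : ℝ, 0 ≤ θ → θ ≤ Real.pi → θ * Real.cos θ ≤ Real.sin θ := by
    intro θ h0 hpi
    rcases lt_or_ge θ (Real.pi / 2) with h | h
    · have hc : 0 < Real.cos θ := Real.cos_pos_of_mem_Ioo ⟨by linarith [Real.pi_pos], h⟩
      have := Real.le_tan h0 h
      rwa [Real.tan_eq_sin_div_cos, le_div_iff₀ hc] at this
    · have hc : Real.cos θ ≤ 0 := Real.cos_nonpos_of_pi_div_two_le_of_le h (by linarith)
      have hs := Real.sin_nonneg_of_nonneg_of_le_pi h0 hpi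
      nlinarith
  have hre : z.re = ‖z‖ * Real.cos z.arg := (Complex.norm_mul_cos_arg z).symm
  have him : z.im = ‖z‖ * Real.sin z.arg := (Complex.norm_mul_sin_arg z).symm
  rcases lt_or_gt_of_ne hz with h | h
  · have ha : z.arg < 0 := Complex.arg_neg_iff.2 h
    rw [div_le_one_of_neg h]
    have := key (-z.arg) (by linarith) (by linarith [Complex.neg_pi_lt_arg z])
    rw [Real.cos_neg, Real.sin_neg] at this
    rw [hre, him]; nlinarith
  · have ha : 0 ≤ z.arg := Complex.arg_nonneg_iff.2 h.le
    rw [div_le_one h]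
    have := key z.arg ha (Complex.arg_le_pi z)
    rw [hre, him]; nlinarith

theorem Complex.arg_div_im_pos {z : ℂ} (hz : z.im ≠ 0) : 0 < z.arg / z.im := by
  rcases lt_or_gt_of_ne hz with h | h
  · exact div_pos_of_neg_of_neg (Complex.arg_neg_iff.2 h) h
  · refine div_pos (lt_of_le_of_ne (Complex.arg_nonneg_iff.2 h.le) fun h0 => ?_) h
    exact hz ((Complex.arg_eq_zero_iff.1 h0.symm).2)

theorem Complex.inv_norm_le_arg_div_im {z : ℂ} (hz : z.im ≠ 0) : ‖z‖⁻¹ ≤ z.arg / z.im := by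
  have hn : 0 < ‖z‖ := norm_pos_iff.2 fun h => hz (by simp [h])
  have him : |z.im| = ‖z‖ * |Real.sin z.arg| := by
    rw [← Complex.norm_mul_sin_arg z, abs_mul, abs_norm]
  have hs : |Real.sin z.arg| ≤ |z.arg| := Real.abs_sin_le_abs
  rw [← abs_of_pos (Complex.arg_div_im_pos hz), abs_div, le_div_iff₀ (abs_pos.2 hz), him,
    inv_mul_cancel_left₀ hn.ne']
  exact hs

/-- Jordan's inequality `|sin θ| ≥ 2|θ|/π`, valid since `|θ| ≤ π/2`. -/
theorem Complex.arg_div_im_le {z : ℂ} (hz : z.im ≠ 0) (hre : 0 ≤ z.re) :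
    z.arg / z.im ≤ Real.pi / 2 / ‖z‖ := by
  have hn : 0 < ‖z‖ := norm_pos_iff.2 fun h => hz (by simp [h])
  have him : |z.im| = ‖z‖ * |Real.sin z.arg| := by
    rw [← Complex.norm_mul_sin_arg z, abs_mul, abs_norm]
  have ha : |z.arg| ≤ Real.pi / 2 := Complex.abs_arg_le_pi_div_two_iff.2 hre
  have hs : 2 / Real.pi * |z.arg| ≤ |Real.sin z.arg| := Real.mul_abs_le_abs_sin ha
  rw [← abs_of_pos (Complex.arg_div_im_pos hz), abs_div, div_le_div_iff₀ (abs_pos.2 hz) hn, him]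
  have : |z.arg| ≤ Real.pi / 2 * |Real.sin z.arg| := by
    have := mul_le_mul_of_nonneg_left hs (by positivity : 0 ≤ Real.pi / 2)
    field_simp at this ⊢; linarith
  nlinarith

namespace AbsolutelyContinuousOnInterval

theorem congr {X : Type*} [PseudoMetricSpace X] {f g : ℝ → X} {a b : ℝ}
    (hf : AbsolutelyContinuousOnInterval f a b) (h : EqOn f g (uIcc a b)) :
    AbsolutelyContinuousOnInterval g a b := by
  refine Tendsto.congr' ?_ hf
  filter_upwards [mem_inf_of_right (mem_principal_self _)] with E hE
  refine Finset.sum_congr rfl fun i hi => ?_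
  rw [h (hE.1 i hi).1, h (hE.1 i hi).2]

theorem of_eq_integral {f g : ℝ → ℝ} {c b : ℝ} (hcb : c ≤ b)
    (hg : IntervalIntegrable g volume c b)
    (hf : ∀ t ∈ Icc c b, f t = f c + ∫ s in c..t, g s) :
    AbsolutelyContinuousOnInterval f c b ∧ ∀ᵐ t, t ∈ Ioo c b → HasDerivAt f (g t) t := by
  constructor
  · have h1 := hg.absolutelyContinuousOnInterval_intervalIntegral (c := c) left_mem_uIcc
    have h2 : AbsolutelyContinuousOnInterval (fun _ : ℝ => f c) c b :=
      (LipschitzWith.const (f c)).lipschitzOnWith.absolutelyContinuousOnInterval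
    refine (h2.add h1).congr fun t ht => ?_
    rw [uIcc_of_le hcb] at ht
    simp [hf t ht]
  · filter_upwards [hg.ae_hasDerivAt_integral] with t ht hm
    have hm' : t ∈ uIcc c b := by rw [uIcc_of_le hcb]; exact Ioo_subset_Icc_self hm
    refine ((ht hm' c left_mem_uIcc).const_add (f c)).congr_of_eventuallyEq ?_
    filter_upwards [Ioo_mem_nhds hm.1 hm.2] with s hs using hf s (Ioo_subset_Icc_self hs)

end AbsolutelyContinuousOnInterval

/-! ### Motion of the line of sight in the heading frame. -/

namespace Engagement

variable {ι : Type*} {E : Engagement ι} {i : ι} {b s t : ℝ}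

theorem Engaged.mono (h : E.Engaged b) (h0 : 0 ≤ t) (htb : t ≤ b) : E.Engaged t :=
  ⟨h0, fun s hs hst => h.2 s hs (hst.trans htb)⟩

theorem InFlight.mono (h : E.InFlight i b) (h0 : E.join i ≤ t) (htb : t ≤ b) : E.InFlight i t :=
  ⟨h0, (WithTop.coe_le_coe.2 htb).trans h.2⟩

theorem InFlight.mem_nodes (h : E.InFlight i b) (h0 : E.join i ≤ t) (htb : t < b) :
    i ∈ E.nodes t :=
  ⟨h0, (WithTop.coe_lt_coe.2 htb).trans_le h.2⟩

theorem inFlight_of_mem_nodes (h : i ∈ E.nodes t) : E.InFlight i t := ⟨h.1, h.2.le⟩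

theorem R_pos (h : E.Engaged t) (hi : E.InFlight i t) : 0 < E.R i t := h.2 t h.1 le_rfl i hi

/-- The line of sight from pursuer `i` to the target in the frame of its heading. -/
noncomputable def rel (E : Engagement ι) (i : ι) (t : ℝ) : ℂ :=
  E.los i t * Complex.exp (-((E.γ i t : ℂ) * Complex.I))

theorem arg_rel : (E.rel i t).arg = E.θ i t := rfl

theorem norm_rel : ‖E.rel i t‖ = E.R i t := by
  rw [rel, norm_mul, ← neg_mul, ← Complex.ofReal_neg, Complex.norm_exp_ofReal_mul_I, mul_one, R]

theorem R_mul_sin : E.R i t * Real.sin (E.θ i t) = (E.rel i t).im := by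
  rw [← norm_rel, ← arg_rel, Complex.norm_mul_sin_arg]

theorem abs_im_rel_le : |(E.rel i t).im| ≤ E.R i t := by
  rw [← norm_rel]; exact Complex.abs_im_le_norm _

theorem rel_im_join_ne_zero (hstart : E.AdmissibleStart) : (E.rel i (E.join i)).im ≠ 0 := by
  intro h
  obtain ⟨_, h0, hpi⟩ := hstart i
  rcases lt_or_ge (E.rel i (E.join i)).re 0 with hre | hre
  · exact hpi (Complex.arg_eq_pi_iff.2 ⟨hre, h⟩)
  · exact h0 (Complex.arg_eq_zero_iff.2 ⟨hre, h⟩)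

theorem aCirc_eq (hR : 0 < E.R i t) :
    E.aCirc i t = 2 * E.V i ^ 2 * (E.rel i t).im / Complex.normSq (E.rel i t) := by
  rw [aCirc, ← R_mul_sin, Complex.normSq_eq_norm_sq, norm_rel]
  field_simp

theorem tEst_eq (h : (E.rel i t).im ≠ 0) :
    E.tEst i t =
      Complex.normSq (E.rel i t) * ((E.rel i t).arg / (E.rel i t).im) / E.V i := by
  have hR : E.R i t ≠ 0 := fun h0 => h (by rw [← R_mul_sin, h0, zero_mul])
  have hs : Real.sin (E.θ i t) ≠ 0 := fun h0 => h (by rw [← R_mul_sin, h0, mul_zero])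
  have hV := (E.V_pos i).ne'
  rw [tEst, Complex.normSq_eq_norm_sq, norm_rel, ← R_mul_sin, arg_rel]
  field_simp

/-- The arc, of length `V t̃`, is at least as long as its chord `R`. -/
theorem R_le_mul_tEst (h : (E.rel i t).im ≠ 0) : E.R i t ≤ E.V i * E.tEst i t := by
  have hR : 0 < ‖E.rel i t‖ := norm_pos_iff.2 fun h0 => h (by simp [h0])
  have h1 := Complex.inv_norm_le_arg_div_im h
  rw [tEst_eq h, mul_div_cancel₀ _ (E.V_pos i).ne', Complex.normSq_eq_norm_sq, ← norm_rel]
  calc ‖E.rel i t‖ = ‖E.rel i t‖ ^ 2 * ‖E.rel i t‖⁻¹ := by field_simp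
    _ ≤ _ := by gcongr

theorem tEst_pos (h : (E.rel i t).im ≠ 0) : 0 < E.tEst i t := by
  have hR : 0 < E.R i t := (abs_pos.2 h).trans_le abs_im_rel_le
  exact pos_of_mul_pos_right (hR.trans_le (R_le_mul_tEst h)) (E.V_pos i).le

/-- If the heading does not point away from the target, the arc is at most a semicircle over the
chord `R`. -/
theorem mul_tEst_le (h : (E.rel i t).im ≠ 0) (hre : 0 ≤ (E.rel i t).re) :
    E.V i * E.tEst i t ≤ Real.pi / 2 * E.R i t := by
  have hR : 0 < ‖E.rel i t‖ := norm_pos_iff.2 fun h0 => h (by simp [h0])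
  have h1 := Complex.arg_div_im_le h hre
  rw [tEst_eq h, mul_div_cancel₀ _ (E.V_pos i).ne', Complex.normSq_eq_norm_sq, ← norm_rel]
  calc _ ≤ ‖E.rel i t‖ ^ 2 * (Real.pi / 2 / ‖E.rel i t‖) := by gcongr
    _ = _ := by field_simp

theorem engaged_of_mem (hE : E.Engaged b) (ht : t ∈ Icc (E.join i) b) : E.Engaged t :=
  hE.mono ((E.join_nonneg i).trans ht.1) ht.2

section Motion

variable (hkin : E.Kinematics) (hE : E.Engaged b) (hb : E.InFlight i b)
include hkin hE hb

theorem γ_motion : AbsolutelyContinuousOnInterval (E.γ i) (E.join i) b ∧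
    ∀ᵐ t, t ∈ Ioo (E.join i) b → HasDerivAt (E.γ i) (E.a i t / E.V i) t :=
  AbsolutelyContinuousOnInterval.of_eq_integral hb.1
    ((hkin.integrable_a i b hE hb).div_const _)
    fun _ ht => hkin.γ_eq i _ (engaged_of_mem hE ht) (hb.mono ht.1 ht.2)

theorem x_motion : AbsolutelyContinuousOnInterval (E.x i) (E.join i) b ∧
    ∀ᵐ t, t ∈ Ioo (E.join i) b → HasDerivAt (E.x i) (E.V i * Real.cos (E.γ i t)) t :=
  AbsolutelyContinuousOnInterval.of_eq_integral hb.1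
    (((Real.continuous_cos.comp_continuousOn
      (γ_motion hkin hE hb).1.continuousOn).const_mul (E.V i)).intervalIntegrable)
    fun _ ht => hkin.x_eq i _ (engaged_of_mem hE ht) (hb.mono ht.1 ht.2)

theorem y_motion : AbsolutelyContinuousOnInterval (E.y i) (E.join i) b ∧
    ∀ᵐ t, t ∈ Ioo (E.join i) b → HasDerivAt (E.y i) (E.V i * Real.sin (E.γ i t)) t :=
  AbsolutelyContinuousOnInterval.of_eq_integral hb.1
    (((Real.continuous_sin.comp_continuousOn
      (γ_motion hkin hE hb).1.continuousOn).const_mul (E.V i)).intervalIntegrable)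
    fun _ ht => hkin.y_eq i _ (engaged_of_mem hE ht) (hb.mono ht.1 ht.2)

omit hkin hE hb in
theorem rel_re : (E.rel i t).re = (E.xT - E.x i t) * Real.cos (E.γ i t) +
    (E.yT - E.y i t) * Real.sin (E.γ i t) := by
  rw [rel, ← neg_mul, ← Complex.ofReal_neg, Complex.mul_re, Complex.exp_ofReal_mul_I_re,
    Complex.exp_ofReal_mul_I_im, Real.cos_neg, Real.sin_neg]
  simp [los]

omit hkin hE hb in
theorem rel_im : (E.rel i t).im = (E.yT - E.y i t) * Real.cos (E.γ i t) -
    (E.xT - E.x i t) * Real.sin (E.γ i t) := by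
  rw [rel, ← neg_mul, ← Complex.ofReal_neg, Complex.mul_im, Complex.exp_ofReal_mul_I_re,
    Complex.exp_ofReal_mul_I_im, Real.cos_neg, Real.sin_neg]
  simp [los]; ring

theorem rel_re_im_ac : AbsolutelyContinuousOnInterval (fun t => (E.rel i t).re) (E.join i) b ∧
    AbsolutelyContinuousOnInterval (fun t => (E.rel i t).im) (E.join i) b := by
  have hγ := (γ_motion hkin hE hb).1
  have hx := (x_motion hkin hE hb).1
  have hy := (y_motion hkin hE hb).1
  have hX := hx.contDiffAt_comp (φ := fun u => E.xT - u) fun _ _ => by fun_prop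
  have hY := hy.contDiffAt_comp (φ := fun u => E.yT - u) fun _ _ => by fun_prop
  have hc := hγ.contDiffAt_comp (φ := Real.cos) fun _ _ => Real.contDiff_cos.contDiffAt
  have hs := hγ.contDiffAt_comp (φ := Real.sin) fun _ _ => Real.contDiff_sin.contDiffAt
  constructor
  · exact ((hX.mul hc).add (hY.mul hs)).congr fun t _ => rel_re.symm
  · exact ((hY.mul hc).sub (hX.mul hs)).congr fun t _ => rel_im.symm

/-- In complex form, `z' = -V - i γ' z` with `γ' = a / V`. -/
theorem rel_hasDerivAt : ∀ᵐ t, t ∈ Ioo (E.join i) b →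
    HasDerivAt (fun t => (E.rel i t).re) (-E.V i + E.a i t / E.V i * (E.rel i t).im) t ∧
    HasDerivAt (fun t => (E.rel i t).im) (-(E.a i t / E.V i * (E.rel i t).re)) t := by
  filter_upwards [(γ_motion hkin hE hb).2, (x_motion hkin hE hb).2, (y_motion hkin hE hb).2]
    with t hγ hx hy ht
  have hX := (hx ht).const_sub E.xT
  have hY := (hy ht).const_sub E.yT
  have hc := (hγ ht).cos
  have hs := (hγ ht).sin
  have hsc := Real.sin_sq_add_cos_sq (E.γ i t)
  simp only [rel_re, rel_im]
  constructor
  · refine ((hX.mul hc).add (hY.mul hs)).congr_deriv ?_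
    linear_combination (-E.V i) * hsc
  · refine ((hY.mul hc).sub (hX.mul hs)).congr_deriv ?_
    ring

end Motion

/-- A tied out-neighbour of a leader is again a leader, so the chain never meets a larger estimate.
Sliding is thus impossible for leaders. -/
theorem not_delayed_of_isLeader (hl : E.IsLeader (E.nodes t) t i) : ¬ E.Delayed t i := by
  intro h
  induction h with
  | larger hadj hlt => exact absurd (hl.2 _ (E.present_of_adj _ _ _ hadj).2) (not_le.2 hlt)
  | tied hadj heq _ ih =>
    exact ih ⟨(E.present_of_adj _ _ _ hadj).2, fun k hk => (hl.2 k hk).trans heq.le⟩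

/-- Merges the alternatives of the law into one weight, keeping only what is used later: full
turning for leaders and straight flight below a larger out-neighbour. -/
theorem exists_weight (hlaw : E.LawAt i t) : ∃ w ∈ Icc (0 : ℝ) 1, E.a i t = w * E.aCirc i t ∧
    (E.IsLeader (E.nodes t) t i → w = 1) ∧
    ((∃ j, (E.graph t).Adj i j ∧ E.tEst i t < E.tEst j t) → w = 0) := by
  by_cases h : ∃ j, (E.graph t).Adj i j ∧ E.tEst i t < E.tEst j t
  · refine ⟨0, by simp, by simp [hlaw.1 h], fun hl => ?_, fun _ => rfl⟩
    obtain ⟨j, hadj, hlt⟩ := h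
    exact absurd (hl.2 _ (E.present_of_adj _ _ _ hadj).2) (not_le.2 hlt)
  · have h' : ∀ j, (E.graph t).Adj i j → E.tEst j t ≤ E.tEst i t := fun j hj =>
      not_lt.1 fun hlt => h ⟨j, hj, hlt⟩
    rcases hlaw.2 h' with h1 | ⟨hd, w, hw, ha⟩
    · exact ⟨1, by simp, by simp [h1], fun _ => rfl, fun h2 => absurd h2 h⟩
    · exact ⟨w, hw, ha, fun hl => absurd hd (not_delayed_of_isLeader hl), fun h2 => absurd h2 h⟩

/-! ### Evolution of the predicted time under the guidance law. -/

section Guided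

variable (hkin : E.Kinematics) (hlaw : E.FollowsGuidanceLaw) (hE : E.Engaged b)
  (hb : E.InFlight i b)
include hkin hlaw hE hb

theorem rel_hasDerivAt_weight : ∀ᵐ t, t ∈ Ioo (E.join i) b → ∃ w ∈ Icc (0 : ℝ) 1,
    HasDerivAt (fun t => (E.rel i t).re)
      (-E.V i + 2 * w * E.V i * (E.rel i t).im / Complex.normSq (E.rel i t) * (E.rel i t).im) t ∧
    HasDerivAt (fun t => (E.rel i t).im)
      (-(2 * w * E.V i * (E.rel i t).im / Complex.normSq (E.rel i t) * (E.rel i t).re)) t ∧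
    (E.IsLeader (E.nodes t) t i → w = 1) ∧
    ((∃ j, (E.graph t).Adj i j ∧ E.tEst i t < E.tEst j t) → w = 0) := by
  filter_upwards [rel_hasDerivAt hkin hE hb, hlaw i] with t hd hl ht
  have hEt := engaged_of_mem hE (Ioo_subset_Icc_self ht)
  obtain ⟨w, hw, ha, h1, h0⟩ := exists_weight (hl hEt (hb.mem_nodes ht.1.le ht.2))
  have hV := (E.V_pos i).ne'
  have hk : E.a i t / E.V i = 2 * w * E.V i * (E.rel i t).im / Complex.normSq (E.rel i t) := by
    rw [ha, aCirc_eq (R_pos hEt (hb.mono ht.1.le ht.2.le))]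
    field_simp
  refine ⟨w, hw, ?_, ?_, h1, h0⟩
  · rw [← hk]; exact (hd ht).1
  · rw [← hk]; exact (hd ht).2

/-- A Grönwall argument keeps `θ` away from `0` and `π`: `(Im z)²` has logarithmic derivative `-4 w
V Re z / |z|²`, which is bounded below because `|z|` stays away from `0` before arrival. -/
theorem rel_im_ne_zero (hstart : E.AdmissibleStart) : (E.rel i b).im ≠ 0 := by
  obtain ⟨hre, him⟩ := rel_re_im_ac hkin hE hb
  have hjb := hb.1
  have hcont : ContinuousOn (fun t => Complex.normSq (E.rel i t)) (Icc (E.join i) b) := by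
    rw [← uIcc_of_le hjb]
    simp only [Complex.normSq_apply]
    exact (hre.continuousOn.mul hre.continuousOn).add (him.continuousOn.mul him.continuousOn)
  obtain ⟨t₀, ht₀, hmin⟩ := isCompact_Icc.exists_isMinOn (nonempty_Icc.2 hjb) hcont
  set r := Complex.normSq (E.rel i t₀) with hr
  have hr0 : 0 < r := by
    rw [hr, Complex.normSq_eq_norm_sq, norm_rel]
    have := R_pos (engaged_of_mem hE ht₀) (hb.mono ht₀.1 ht₀.2)
    positivity
  obtain ⟨M, hM⟩ := hre.exists_bound
  rw [uIcc_of_le hjb] at hM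
  have hM0 : 0 ≤ M := (norm_nonneg _).trans (hM _ (left_mem_Icc.2 hjb))
  have hV := E.V_pos i
  -- `C` dominates `4 w V Re z / |z|²`, so `(Im z)² e^{Ct}` is nondecreasing.
  set C := 4 * E.V i * M / r with hC
  have hexp := (LipschitzWith.id.lipschitzOnWith (s := uIcc (E.join i) b)
    ).absolutelyContinuousOnInterval.contDiffAt_comp (φ := fun t => Real.exp (C * t))
    fun _ _ => by fun_prop
  have hmono := AbsolutelyContinuousOnInterval.le_of_ae_hasDerivAt_nonneg hjb
    ((him.mul him).mul hexp) (by
      filter_upwards [rel_hasDerivAt_weight hkin hlaw hE hb] with t ht hm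
      obtain ⟨w, hw, -, hd, -, -⟩ := ht hm
      have he : HasDerivAt (fun t => Real.exp (C * t)) (Real.exp (C * t) * (C * 1)) t :=
        ((hasDerivAt_id t).const_mul C).exp
      refine ⟨_, ?_, (hd.mul hd).mul he⟩
      have hn : r ≤ Complex.normSq (E.rel i t) := hmin (Ioo_subset_Icc_self hm)
      have hn0 := hr0.trans_le hn
      have hp : (E.rel i t).re ≤ M :=
        (le_abs_self _).trans (hM t (Ioo_subset_Icc_self hm))
      have key : 0 ≤ C - 4 * w * E.V i * (E.rel i t).re / Complex.normSq (E.rel i t) := by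
        rw [sub_nonneg, hC]
        calc 4 * w * E.V i * (E.rel i t).re / Complex.normSq (E.rel i t)
            ≤ 4 * E.V i * M / Complex.normSq (E.rel i t) := by
              refine div_le_div_of_nonneg_right ?_ hn0.le
              have h1 := mul_le_mul_of_nonneg_left hp (mul_nonneg hw.1 hV.le)
              have h2 := mul_le_mul_of_nonneg_right hw.2 (mul_nonneg hV.le hM0)
              linarith
          _ ≤ _ := by gcongr
      have := mul_nonneg (mul_nonneg (sq_nonneg (E.rel i t).im) key) (Real.exp_pos (C * t)).le
      refine this.trans_eq ?_
      simp only [Pi.mul_apply, id_eq]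
      field_simp
      ring)
  intro h0
  have h1 : (E.rel i (E.join i)).im * (E.rel i (E.join i)).im *
      Real.exp (C * E.join i) ≤ 0 := by
    simpa [h0] using hmono
  have h2 := mul_self_pos.2 (rel_im_join_ne_zero (i := i) hstart)
  have := mul_pos h2 (Real.exp_pos (C * E.join i))
  linarith

variable (hstart : E.AdmissibleStart)
include hstart

theorem rel_im_ne_zero_of_mem (ht : t ∈ Icc (E.join i) b) : (E.rel i t).im ≠ 0 :=
  rel_im_ne_zero hkin hlaw (engaged_of_mem hE ht) (hb.mono ht.1 ht.2) hstart

theorem tEst_ac : AbsolutelyContinuousOnInterval (E.tEst i) (E.join i) b := by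
  obtain ⟨hre, him⟩ := rel_re_im_ac hkin hE hb
  have hjb := hb.1
  have hne : ∀ t ∈ uIcc (E.join i) b, (E.rel i t).im ≠ 0 := fun t ht =>
    rel_im_ne_zero_of_mem hkin hlaw hE hb hstart (by rwa [uIcc_of_le hjb] at ht)
  have hz : AbsolutelyContinuousOnInterval (E.rel i) (E.join i) b := by
    have h1 := hre.contDiffAt_comp (φ := Complex.ofRealCLM)
      fun _ _ => Complex.ofRealCLM.contDiff.contDiffAt
    have h2 := him.contDiffAt_comp (φ := fun u => Complex.ofRealCLM u * Complex.I)
      fun _ _ => by fun_prop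
    exact (h1.add h2).congr fun t _ => by simp [Complex.re_add_im]
  have harg : AbsolutelyContinuousOnInterval (fun t => (E.rel i t).arg) (E.join i) b := by
    -- As `Im z ≠ 0`, the path avoids the branch cut of the logarithm.
    refine (hz.contDiffAt_comp (φ := fun z => Complex.imCLM (Complex.log z)) fun t ht => ?_).congr
      fun t _ => by simp [Complex.log_im]
    refine Complex.imCLM.contDiff.contDiffAt.comp _ ?_
    exact ((Complex.contDiffAt_log (Or.inr (hne t ht))).restrict_scalars ℝ)
  have hinv := him.contDiffAt_comp (φ := fun u => u⁻¹)
    fun t ht => contDiffAt_inv ℝ (hne t ht)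
  have := (((hre.mul hre).add (him.mul him)).mul (harg.mul hinv)).const_mul (E.V i)⁻¹
  refine this.congr fun t ht => ?_
  rw [tEst_eq (hne t ht), Complex.normSq_apply]
  simp only [Pi.mul_apply, Pi.add_apply]
  ring

theorem tEst_hasDerivAt : ∀ᵐ t, t ∈ Ioo (E.join i) b → ∃ d, 0 ≤ d ∧
    HasDerivAt (fun t => t + E.tEst i t) d t ∧ (E.IsLeader (E.nodes t) t i → d = 0) := by
  filter_upwards [rel_hasDerivAt_weight hkin hlaw hE hb] with t ht hm
  obtain ⟨w, hw, hre, him, hlead, -⟩ := ht hm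
  have hne := rel_im_ne_zero_of_mem hkin hlaw hE hb hstart (Ioo_subset_Icc_self hm)
  -- This is `2 (1 - w) (1 - θ cot θ)`.
  refine ⟨2 * (1 - w) * (1 - (E.rel i t).arg * (E.rel i t).re / (E.rel i t).im), ?_, ?_, ?_⟩
  · have h1 := Complex.arg_mul_re_le_im_mul hne
    have := hw.2
    exact mul_nonneg (by linarith) (by linarith)
  · set d := -E.V i + 2 * w * E.V i * (E.rel i t).im / Complex.normSq (E.rel i t) *
      (E.rel i t).im with hd
    set e := -(2 * w * E.V i * (E.rel i t).im / Complex.normSq (E.rel i t) *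
      (E.rel i t).re) with he
    have hz : HasDerivAt (E.rel i) (d + e * Complex.I) t := by
      refine (hre.ofReal_comp.add (him.ofReal_comp.mul_const Complex.I)).congr_of_eventuallyEq ?_
      exact Eventually.of_forall fun s => by simp [Complex.re_add_im]
    have hlog := hz.clog_real (Or.inr hne)
    have harg : HasDerivAt (fun t => (E.rel i t).arg)
        ((d + e * Complex.I) / E.rel i t).im t := by
      simpa [Function.comp_def, Complex.log_im] using
        Complex.imCLM.hasFDerivAt.comp_hasDerivAt t hlog
    have hF := (hasDerivAt_id t).add
      ((((hre.mul hre).add (him.mul him)).mul (harg.mul (him.inv hne))).div_const (E.V i))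
    have hF' := hF.congr_of_eventuallyEq (f₁ := fun t => t + E.tEst i t) (by
      filter_upwards [Ioo_mem_nhds hm.1 hm.2] with s hs
      rw [tEst_eq (rel_im_ne_zero_of_mem hkin hlaw hE hb hstart (Ioo_subset_Icc_self hs)),
        Complex.normSq_apply, div_eq_mul_inv (E.rel i s).arg]
      rfl)
    refine hF'.congr_deriv ?_
    have hn : Complex.normSq (E.rel i t) ≠ 0 := by
      rw [Ne, Complex.normSq_eq_zero]; exact fun h => hne (by simp [h])
    have hV := (E.V_pos i).ne'
    rw [Complex.div_im]
    have hn' := Complex.normSq_apply (E.rel i t)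
    simp only [Complex.add_re, Complex.add_im, Complex.ofReal_re, Complex.ofReal_im,
      Complex.mul_re, Complex.mul_im, Complex.I_re, Complex.I_im, Pi.mul_apply, Pi.add_apply,
      Pi.inv_apply]
    rw [← hn', hd, he]
    generalize (E.rel i t).re = p at *
    generalize (E.rel i t).im = q at *
    generalize (E.rel i t).arg = A at *
    generalize Complex.normSq (E.rel i t) = n at *
    generalize E.V i = v at *
    field_simp
    subst hn'
    ring
  · intro hl
    rw [hlead hl]; ring

theorem add_tEst_ac :
    AbsolutelyContinuousOnInterval (fun t => t + E.tEst i t) (E.join i) b :=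
  (LipschitzWith.id.lipschitzOnWith (s := uIcc (E.join i) b)).absolutelyContinuousOnInterval.add
    (tEst_ac hkin hlaw hE hb hstart)

theorem add_tEst_mono (hs : E.join i ≤ s) (hsb : s ≤ b) : s + E.tEst i s ≤ b + E.tEst i b := by
  refine AbsolutelyContinuousOnInterval.le_of_ae_hasDerivAt_nonneg (f := fun t => t + E.tEst i t)
    hsb ((add_tEst_ac hkin hlaw hE hb hstart).mono ?_) ?_
  · rw [uIcc_of_le hsb, uIcc_of_le hb.1]; exact Icc_subset_Icc_left hs
  · filter_upwards [tEst_hasDerivAt hkin hlaw hE hb hstart] with t ht hm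
    obtain ⟨d, h0, hd, -⟩ := ht ⟨hs.trans_lt hm.1, hm.2⟩
    exact ⟨d, h0, hd⟩

end Guided

end Engagement

/-! ### The largest prediction, static periods and the first arrival. -/

namespace Engagement

variable {ι : Type*} {E : Engagement ι} {i j l : ι} {b s t u : ℝ}

/-- The largest predicted interception time does not increase while the node set is constant. -/
theorem add_tEst_le_leader [Finite ι] (hkin : E.Kinematics) (hlaw : E.FollowsGuidanceLaw)
    (hstart : E.AdmissibleStart) (hE : E.Engaged b) (hsb : s ≤ b)
    (hnodes : ∀ u ∈ Icc s b, E.nodes u = E.nodes s) (hl : E.IsLeader (E.nodes s) s l)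
    (hi : i ∈ E.nodes s) : b + E.tEst i b ≤ s + E.tEst l s := by
  classical
  set W := (Set.toFinite (E.nodes s)).toFinset with hW
  have hWmem : ∀ k, k ∈ W ↔ k ∈ E.nodes s := fun k => by simp [hW]
  have hne : W.Nonempty := ⟨l, (hWmem l).2 hl.1⟩
  have hfl : ∀ k ∈ E.nodes s, E.InFlight k b := fun k hk =>
    inFlight_of_mem_nodes (by rw [hnodes b (right_mem_Icc.2 hsb)]; exact hk)
  let F : ι → ℝ → ℝ := fun k t => t + E.tEst k t
  have hF : ∀ k t, F k t = t + E.tEst k t := fun _ _ => rfl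
  have hac : ∀ k ∈ W, AbsolutelyContinuousOnInterval (F k) s b := fun k hk => by
    have hk' := (hWmem k).1 hk
    refine (add_tEst_ac hkin hlaw hE (hfl k hk') hstart).mono ?_
    rw [uIcc_of_le hsb, uIcc_of_le (hk'.1.trans hsb)]
    exact Icc_subset_Icc_left hk'.1
  have hM : AbsolutelyContinuousOnInterval (W.sup' hne F) s b :=
    Finset.sup'_induction hne F (p := fun f => AbsolutelyContinuousOnInterval f s b)
      (fun _ h _ h' => h.sup h') hac
  have hle : ∀ k ∈ W, ∀ t, F k t ≤ W.sup' hne F t := fun k hk t =>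
    (Finset.le_sup' F hk : F k ≤ W.sup' hne F) t
  -- The maximum `M` of the predictions has derivative `0` almost everywhere, hence is constant.
  have hconst := AbsolutelyContinuousOnInterval.eq_of_ae_hasDerivAt_zero hsb hM (by
    have hall : ∀ᵐ t, ∀ k ∈ W, t ∈ Ioo (E.join k) b → ∃ d, 0 ≤ d ∧
        HasDerivAt (fun t => t + E.tEst k t) d t ∧ (E.IsLeader (E.nodes t) t k → d = 0) := by
      rw [ae_all_iff]
      intro k
      by_cases hk : k ∈ W
      · filter_upwards [tEst_hasDerivAt hkin hlaw hE (hfl k ((hWmem k).1 hk)) hstart] with t ht _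
          using ht
      · exact Eventually.of_forall fun _ h => absurd h hk
    filter_upwards [hall, hM.ae_differentiableAt] with t ht hdiff hm
    have hMd := (hdiff (by rw [uIcc_of_le hsb]; exact Ioo_subset_Icc_self hm)).hasDerivAt
    obtain ⟨k, hk, hkeq⟩ := Finset.exists_mem_eq_sup' hne (fun k => F k t)
    have hkM : W.sup' hne F t = F k t := by rw [Finset.sup'_apply]; exact hkeq
    obtain ⟨d, -, hd, hd0⟩ := ht k hk ⟨((hWmem k).1 hk).1.trans_lt hm.1, hm.2⟩
    have hlead : E.IsLeader (E.nodes t) t k := by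
      rw [hnodes t (Ioo_subset_Icc_self hm)]
      refine ⟨(hWmem k).1 hk, fun m hm' => ?_⟩
      have := hle m ((hWmem m).2 hm') t
      rw [hkM, hF, hF] at this
      linarith
    rw [hd0 hlead] at hd
    -- `M` minus the prediction of `k` is nonnegative and vanishes at `t`, so the two derivatives
    -- agree there.
    have hmin : IsLocalMin (fun u => W.sup' hne F u - (u + E.tEst k u)) t :=
      Eventually.of_forall fun u => by
        have h1 := hle k hk u
        rw [hF] at h1 hkM
        simp only
        linarith
    have := hmin.hasDerivAt_eq_zero (hMd.sub hd)
    rw [sub_zero] at this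
    rwa [this] at hMd)
  have h1 := hle i ((hWmem i).2 hi) b
  rw [← hconst, Finset.sup'_apply] at h1
  refine h1.trans (Finset.sup'_le _ _ fun k hk => ?_)
  have := hl.2 k ((hWmem k).1 hk)
  rw [hF]; linarith

/-- The graph and its node set do not change on `[s, b)`. -/
def Static (E : Engagement ι) (s b : ℝ) : Prop :=
  ∀ u ∈ Ico s b, E.nodes u = E.nodes s ∧ E.graph u = E.graph s

theorem Static.mono (h : E.Static s b) (hu : s ≤ u) : E.Static u b := by
  intro v hv
  have h1 := h v ⟨hu.trans hv.1, hv.2⟩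
  have h2 := h u ⟨hu, hv.1.trans_lt hv.2⟩
  exact ⟨h1.1.trans h2.1.symm, h1.2.trans h2.2.symm⟩

/-- The initial maximum bounds every prediction, while the leader's own prediction cannot fall below
it. -/
theorem Static.isLeader [Finite ι] (h : E.Static s b) (hkin : E.Kinematics)
    (hlaw : E.FollowsGuidanceLaw) (hstart : E.AdmissibleStart) (ht : t ∈ Ico s b)
    (hE : E.Engaged t) (hl : E.IsLeader (E.nodes s) s l) :
    E.IsLeader (E.nodes s) t l ∧ t + E.tEst l t = s + E.tEst l s := by
  have hn : ∀ u ∈ Icc s t, E.nodes u = E.nodes s := fun u hu => (h u ⟨hu.1, hu.2.trans_lt ht.2⟩).1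
  have hle : ∀ i ∈ E.nodes s, t + E.tEst i t ≤ s + E.tEst l s := fun i hi =>
    add_tEst_le_leader hkin hlaw hstart hE ht.1 hn hl hi
  have hge : s + E.tEst l s ≤ t + E.tEst l t :=
    add_tEst_mono hkin hlaw hE (inFlight_of_mem_nodes (by rw [hn t ⟨ht.1, le_rfl⟩]; exact hl.1))
      hstart hl.1.1 ht.1
  refine ⟨⟨hl.1, fun i hi => ?_⟩, le_antisymm (hle l hl.1) hge⟩
  linarith [hle i hi]

theorem Static.connected [Finite ι] (h : E.Static s b) (hkin : E.Kinematics)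
    (hlaw : E.FollowsGuidanceLaw) (hstart : E.AdmissibleStart) (ht : t ∈ Ico s b)
    (hE : E.Engaged t) (hc : E.Connected s) : E.Connected t := by
  obtain ⟨l, hl, hr⟩ := hc
  refine ⟨l, ?_, ?_⟩
  · rw [(h t ht).1]; exact (h.isLeader hkin hlaw hstart ht hE hl).1
  · rw [(h t ht).1, GloballyReachable, (h t ht).2]; exact hr

/-- The instants at which the graph may change. -/
def events (E : Engagement ι) : Set ℝ :=
  range E.join ∪ {t | (t : WithTop ℝ) ∈ range E.leave} ∪ E.switches

theorem finite_joins_union_leaves [Finite ι] :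
    (range E.join ∪ {t : ℝ | (t : WithTop ℝ) ∈ range E.leave}).Finite :=
  (finite_range _).union ((finite_range E.leave).preimage WithTop.coe_injective.injOn)

theorem finite_events_inter [Finite ι] (T : ℝ) : (E.events ∩ Icc 0 T).Finite := by
  rw [events, union_inter_distrib_right]
  exact (finite_joins_union_leaves.inter_of_left _).union (E.switches_finite T)

theorem nodes_eq_of_no_event (hst : s ≤ t)
    (h : ∀ u ∈ Ioc s t, u ∉ range E.join ∪ {t : ℝ | (t : WithTop ℝ) ∈ range E.leave}) :
    E.nodes t = E.nodes s := by
  ext i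
  constructor
  · rintro ⟨h1, h2⟩
    refine ⟨not_lt.1 fun h3 => h _ ⟨h3, h1⟩ (Or.inl ⟨i, rfl⟩), ?_⟩
    exact (WithTop.coe_le_coe.2 hst).trans_lt h2
  · rintro ⟨h1, h2⟩
    refine ⟨h1.trans hst, not_le.1 fun h3 => ?_⟩
    cases hv : E.leave i with
    | top => simp [hv] at h3
    | coe v =>
      rw [hv] at h2 h3
      exact h v ⟨WithTop.coe_lt_coe.1 h2, WithTop.coe_le_coe.1 h3⟩ (Or.inr ⟨i, hv⟩)

theorem static_of_no_event (hs : 0 ≤ s) (h : ∀ u ∈ Ioo s b, u ∉ E.events) : E.Static s b := by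
  intro u hu
  have h' : ∀ v ∈ Ioc s u, v ∉ E.events := fun v hv => h v ⟨hv.1, hv.2.trans_lt hu.2⟩
  exact ⟨nodes_eq_of_no_event hu.1 fun v hv hm => h' v hv (Or.inl hm),
    (E.static_between s u hs hu.1 fun v hv hm => h' v hv (Or.inr hm)).symm⟩

theorem exists_no_event [Finite ι] (t : ℝ) :
    ∃ ε > 0, ∀ u, 0 ≤ u → |u - t| < ε → u ≠ t → u ∉ E.events := by
  have hfin := (E.finite_events_inter (t + 1)).subset (sdiff_subset (t := {t}))
  have hmem : ((E.events ∩ Icc 0 (t + 1)) \ {t} : Set ℝ)ᶜ ∈ 𝓝 t :=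
    hfin.isClosed.isOpen_compl.mem_nhds (by simp)
  obtain ⟨ε, hε, hball⟩ := Metric.mem_nhds_iff.1 hmem
  refine ⟨min ε 1, by positivity, fun u hu hlt hne hev => ?_⟩
  refine hball (Metric.mem_ball.2 (hlt.trans_le (min_le_left _ _))) ⟨⟨hev, hu, ?_⟩, hne⟩
  linarith [(abs_lt.1 (hlt.trans_le (min_le_right _ _))).2]

theorem exists_static_left [Finite ι] (ht : 0 < t) : ∃ s, 0 ≤ s ∧ s < t ∧ E.Static s t := by
  obtain ⟨ε, hε, h⟩ := E.exists_no_event t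
  refine ⟨max 0 (t - ε), le_max_left _ _, max_lt ht (by linarith),
    static_of_no_event (le_max_left _ _) fun u hu => ?_⟩
  obtain ⟨h1, h2⟩ := max_lt_iff.1 hu.1
  exact h u h1.le (by rw [abs_lt]; constructor <;> linarith [hu.2]) hu.2.ne

theorem exists_static_right [Finite ι] (ht : 0 ≤ t) : ∃ b, t < b ∧ E.Static t b := by
  obtain ⟨ε, hε, h⟩ := E.exists_no_event t
  refine ⟨t + ε, by linarith, static_of_no_event ht fun u hu => ?_⟩
  exact h u (ht.trans hu.1.le) (by rw [abs_lt]; constructor <;> linarith [hu.1, hu.2]) hu.1.ne'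

/-- After the latest removal up to `t`, the removal condition supplies a leader, and this node
cannot have left since. -/
theorem nodes_nonempty [Finite ι] (hne : ∃ i, E.join i = 0) (hrem : E.RemovalCondition)
    (hE : E.Engaged t) : (E.nodes t).Nonempty := by
  by_cases h : ∃ i, E.leave i ≤ t
  · obtain ⟨i, hi, hmax⟩ := (Set.toFinite {i | E.leave i ≤ t}).exists_maximalFor E.leave _ h
    obtain ⟨v, hv⟩ := WithTop.ne_top_iff_exists.1
      (LE.le.trans_lt (b := (t : WithTop ℝ)) hi (WithTop.coe_lt_top t)).ne
    have hvt : v ≤ t := by rw [mem_ofPred_eq, ← hv] at hi; exact WithTop.coe_le_coe.1 hi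
    have hv0 : 0 ≤ v := by
      have := E.join_lt_leave i
      rw [← hv] at this
      exact (E.join_nonneg i).trans (WithTop.coe_lt_coe.1 this).le
    obtain ⟨l, hl, -⟩ := hrem i v hv.symm (hE.mono hv0 hvt)
    refine ⟨l, hl.1.1.trans hvt, not_le.1 fun h3 => ?_⟩
    have h4 : E.leave i < E.leave l := by rw [← hv]; exact hl.1.2
    exact absurd (hmax h3 h4.le) (not_le.2 h4)
  · obtain ⟨i, hi⟩ := hne
    exact ⟨i, hi.trans_le hE.1, not_le.1 fun h3 => h ⟨i, h3⟩⟩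

/-- After the last joining or removal all predictions are at most a fixed time. Flying on until then
would make a positive estimate nonpositive. -/
theorem exists_not_engaged [Finite ι] (hne : ∃ i, E.join i = 0) (hkin : E.Kinematics)
    (hlaw : E.FollowsGuidanceLaw) (hstart : E.AdmissibleStart) (hrem : E.RemovalCondition) :
    ∃ t, 0 ≤ t ∧ ¬ E.Engaged t := by
  by_contra! hE
  obtain ⟨T, hT⟩ := (finite_joins_union_leaves (E := E)).bddAbove
  set s := max T 0
  have hs0 : 0 ≤ s := le_max_right _ _
  have hn : ∀ u, s ≤ u → E.nodes u = E.nodes s := fun u hu =>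
    nodes_eq_of_no_event hu fun v hv hm =>
      absurd (hT hm) (not_le.2 ((le_max_left _ _).trans_lt hv.1))
  obtain ⟨l, hl, hmax⟩ := (Set.toFinite (E.nodes s)).exists_maximalFor (fun i => E.tEst i s) _
    (nodes_nonempty hne hrem (hE s hs0))
  have hlead : E.IsLeader (E.nodes s) s l := ⟨hl, fun j hj => by
    by_contra! h
    exact absurd (hmax hj h.le) (not_le.2 h)⟩
  set b := max s (s + E.tEst l s)
  have hsb : s ≤ b := le_max_left _ _
  have hEb := hE b (hs0.trans hsb)
  have h1 := add_tEst_le_leader hkin hlaw hstart hEb hsb (fun u hu => hn u hu.1) hlead hl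
  have h2 := tEst_pos (rel_im_ne_zero hkin hlaw hEb
    (inFlight_of_mem_nodes (by rw [hn b hsb]; exact hl)) hstart)
  have h3 : s + E.tEst l s ≤ b := le_max_right _ _
  linarith

theorem isClosed_inFlight : IsClosed {t | E.InFlight i t} := by
  cases hv : E.leave i with
  | top =>
    have : {t | E.InFlight i t} = Ici (E.join i) := by
      ext t; simp [InFlight, hv]
    rw [this]; exact isClosed_Ici
  | coe v =>
    have : {t | E.InFlight i t} = Icc (E.join i) v := by
      ext t; simp [InFlight, hv, WithTop.coe_le_coe]
    rw [this]; exact isClosed_Icc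

theorem continuousOn_R (hkin : E.Kinematics) : ContinuousOn (E.R i) {t | E.InFlight i t} := by
  have : E.R i = fun t => √((E.xT - E.x i t) * (E.xT - E.x i t) +
      (E.yT - E.y i t) * (E.yT - E.y i t)) := by
    funext t; rw [R, Complex.norm_def, Complex.normSq_apply]; rfl
  rw [this]
  have hx := (continuousOn_const (c := E.xT)).sub (hkin.continuousOn_x i)
  have hy := (continuousOn_const (c := E.yT)).sub (hkin.continuousOn_y i)
  exact ((hx.mul hx).add (hy.mul hy)).sqrt

theorem R_eq_zero_iff : E.R i t = 0 ↔ E.x i t = E.xT ∧ E.y i t = E.yT := by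
  rw [R, norm_eq_zero, Complex.ext_iff]
  simp only [los, Complex.zero_re, Complex.zero_im, sub_eq_zero]
  rw [eq_comm (a := E.xT), eq_comm (a := E.yT)]

/-- There is a first instant at which some pursuer of the network is at the target. -/
theorem exists_first_arrival [Finite ι] (hkin : E.Kinematics) (h : ∃ t, 0 ≤ t ∧ ¬ E.Engaged t) :
    ∃ tf, (∃ i, E.InFlight i tf ∧ E.R i tf = 0) ∧ ∀ t, 0 ≤ t → t < tf → E.Engaged t := by
  -- Flight periods include the removal instant, which makes the set `H` of arrival times closed, so
  -- that its infimum is attained.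
  set H := ⋃ i, {t | E.InFlight i t} ∩ E.R i ⁻¹' {0} with hH
  have hHmem : ∀ t, t ∈ H ↔ ∃ i, E.InFlight i t ∧ E.R i t = 0 := fun t => by simp [hH]
  have hcl : IsClosed H := isClosed_iUnion_of_finite fun i =>
    (continuousOn_R hkin).preimage_isClosed_of_isClosed isClosed_inFlight isClosed_singleton
  have hbdd : BddBelow H := ⟨0, fun t ht => by
    obtain ⟨i, hi, -⟩ := (hHmem t).1 ht
    exact (E.join_nonneg i).trans hi.1⟩
  have hR : ∀ i t, 0 ≤ E.R i t := fun i t => norm_nonneg _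
  have hneH : H.Nonempty := by
    obtain ⟨t, h0, ht⟩ := h
    by_contra hemp
    refine ht ⟨h0, fun s _ _ i hi => lt_of_le_of_ne (hR i s) fun hz => hemp ⟨s, ?_⟩⟩
    exact (hHmem s).2 ⟨i, hi, hz.symm⟩
  refine ⟨sInf H, (hHmem _).1 (hcl.csInf_mem hneH hbdd), fun t h0 ht => ⟨h0, ?_⟩⟩
  intro s _ hst i hi
  refine lt_of_le_of_ne (hR i s) fun hz => ?_
  exact absurd (csInf_le hbdd ((hHmem s).2 ⟨i, hi, hz.symm⟩)) (not_le.2 (hst.trans_lt ht))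

end Engagement

/-! ### Behaviour of the pursuers up to the first arrival. -/

namespace Engagement

variable {ι : Type*} {E : Engagement ι} {i j l : ι} {b s t u : ℝ}

theorem tendsto_R (hkin : E.Kinematics) (hb : E.InFlight i b) (hj : E.join i < b) :
    Tendsto (E.R i) (𝓝[<] b) (𝓝 (E.R i b)) := by
  rw [← nhdsWithin_Ico_eq_nhdsLT hj]
  exact ((continuousOn_R hkin) b hb).mono_left
    (nhdsWithin_mono _ fun t ht => hb.mono ht.1 ht.2.le)

section Arrival

variable (hkin : E.Kinematics) (hlaw : E.FollowsGuidanceLaw) (hstart : E.AdmissibleStart)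
  (hE : ∀ t, 0 ≤ t → t < b → E.Engaged t)
include hkin hlaw hstart hE

theorem rel_im_ne_zero_before (hb : E.InFlight i b) (ht : t ∈ Ico (E.join i) b) :
    (E.rel i t).im ≠ 0 :=
  rel_im_ne_zero hkin hlaw (hE t ((E.join_nonneg i).trans ht.1) ht.2) (hb.mono ht.1 ht.2.le) hstart

theorem add_tEst_mono_before (hb : E.InFlight i b) (hs : E.join i ≤ s) (hst : s ≤ t)
    (ht : t < b) : s + E.tEst i s ≤ t + E.tEst i t :=
  add_tEst_mono hkin hlaw (hE t ((E.join_nonneg i).trans (hs.trans hst)) ht)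
    (hb.mono (hs.trans hst) ht.le) hstart hs hst

/-- A pursuer does not arrive before a time that it once predicted. -/
theorem add_tEst_le_arrival (hb : E.InFlight j b) (hR : E.R j b = 0)
    (hu : u ∈ Ico (E.join j) b) : u + E.tEst j u ≤ b := by
  by_contra! hlt
  have hj : E.join j < b := hu.1.trans_lt hu.2
  have hV := E.V_pos j
  set c := u + E.tEst j u - b with hc
  have hlim := tendsto_R hkin hb hj
  rw [hR] at hlim
  have hsmall : ∀ᶠ t in 𝓝[<] b, E.R j t < E.V j * c / (Real.pi / 2) :=
    hlim.eventually_lt_const (by have := Real.pi_pos; have : 0 < c := by linarith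
                                 positivity)
  obtain ⟨v, hvb, hv⟩ := (mem_nhdsLT_iff_exists_Ioo_subset' hu.2).1
    (inter_mem hsmall (Ioo_mem_nhdsLT hu.2))
  -- Near `b` the estimate is still at least `c` while `R` is too small for an arc of at most a
  -- semicircle, so the heading points away from the target.
  have hre : ∀ t ∈ Ioo v b, (E.rel j t).re < 0 := by
    intro t ht
    by_contra! h0
    have hut := (hv ht).2
    have hR' : E.R j t < E.V j * c / (Real.pi / 2) := (hv ht).1
    have h1 := mul_tEst_le (rel_im_ne_zero_before hkin hlaw hstart hE hb
      ⟨hu.1.trans hut.1.le, ht.2⟩) h0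
    have h2 := add_tEst_mono_before hkin hlaw hstart hE hb hu.1 hut.1.le ht.2
    have h3 : E.V j * c ≤ E.V j * E.tEst j t :=
      mul_le_mul_of_nonneg_left (by linarith [ht.2]) hV.le
    rw [lt_div_iff₀ (by positivity)] at hR'
    linarith
  obtain ⟨r, hr⟩ := exists_between (show v < b from hvb)
  have hur := (hv hr).2
  -- `(R²)' = -2 V Re z > 0`, since the turning terms cancel. A growing distance cannot tend to `0`.
  have hmono : ∀ t ∈ Ioo r b, E.R j r ≤ E.R j t := by
    intro t ht
    have hjt : E.join j ≤ t := hu.1.trans (hur.1.trans ht.1).le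
    have hEt := hE t ((E.join_nonneg j).trans hjt) ht.2
    have hbt := hb.mono hjt ht.2.le
    obtain ⟨hx, hy⟩ := rel_re_im_ac hkin hEt hbt
    have hsub : uIcc r t ⊆ uIcc (E.join j) t := by
      rw [uIcc_of_le ht.1.le, uIcc_of_le hjt]; exact Icc_subset_Icc_left (hu.1.trans hur.1.le)
    have := AbsolutelyContinuousOnInterval.le_of_ae_hasDerivAt_nonneg ht.1.le
      (((hx.mul hx).add (hy.mul hy)).mono hsub) (by
        filter_upwards [rel_hasDerivAt hkin hEt hbt] with τ hτ hm
        obtain ⟨h1, h2⟩ := hτ ⟨(hu.1.trans_lt hur.1).trans hm.1, hm.2⟩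
        refine ⟨_, ?_, (h1.mul h1).add (h2.mul h2)⟩
        have := hre τ ⟨hr.1.trans hm.1, hm.2.trans ht.2⟩
        have := mul_pos hV (neg_pos.2 this)
        nlinarith)
    have h2 : E.R j r ^ 2 ≤ E.R j t ^ 2 := by
      rw [← norm_rel, ← norm_rel, ← Complex.normSq_eq_norm_sq, ← Complex.normSq_eq_norm_sq,
        Complex.normSq_apply, Complex.normSq_apply]
      exact this
    exact (pow_le_pow_iff_left₀ (norm_nonneg _) (norm_nonneg _) two_ne_zero).1 h2
  have hRr : E.R j r ≤ 0 := ge_of_tendsto hlim (by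
    filter_upwards [Ioo_mem_nhdsLT hr.2] with t ht using hmono t ht)
  have := R_pos (hE r ((E.join_nonneg j).trans (hu.1.trans hur.1.le)) hr.2)
    (hb.mono (hu.1.trans hur.1.le) hr.2.le)
  linarith

/-- A pursuer that keeps an out-neighbour with larger estimate flies straight and misses. -/
theorem R_ne_zero_of_larger (hb : E.InFlight i b) (hu : u ∈ Ico (E.join i) b)
    (h : ∀ t ∈ Ioo u b, ∃ k, (E.graph t).Adj i k ∧ E.tEst i t < E.tEst k t) : E.R i b ≠ 0 := by
  intro hR
  have hlim := tendsto_R hkin hb (hu.1.trans_lt hu.2)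
  rw [hR] at hlim
  -- In straight flight `Im z`, the signed miss distance, is constant, and `|Im z| ≤ R → 0`.
  have hge : |(E.rel i u).im| ≤ 0 := ge_of_tendsto hlim (by
    filter_upwards [Ioo_mem_nhdsLT hu.2] with t ht
    have hjt : E.join i ≤ t := hu.1.trans ht.1.le
    have hEt := hE t ((E.join_nonneg i).trans hjt) ht.2
    have hbt := hb.mono hjt ht.2.le
    have hac := (rel_re_im_ac hkin hEt hbt).2.mono (c := u) (d := t) (by
      rw [uIcc_of_le ht.1.le, uIcc_of_le hjt]; exact Icc_subset_Icc_left hu.1)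
    have := AbsolutelyContinuousOnInterval.eq_of_ae_hasDerivAt_zero ht.1.le hac (by
      filter_upwards [rel_hasDerivAt_weight hkin hlaw hEt hbt] with τ hτ hm
      obtain ⟨w, -, -, hd, -, h0⟩ := hτ ⟨hu.1.trans_lt hm.1, hm.2⟩
      simpa [h0 (h τ ⟨hm.1, hm.2.trans ht.2⟩)] using hd)
    rw [this]
    exact abs_im_rel_le)
  exact rel_im_ne_zero_before hkin hlaw hstart hE hb hu (abs_nonpos_iff.1 hge)

/-- Squeeze: `0 < t̃ ≤ b - t` and `R ≤ V t̃`. -/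
theorem arrives_of_add_tEst_le (hb : E.InFlight i b) (hj : E.join i < b)
    (h : ∀ t ∈ Ico (E.join i) b, t + E.tEst i t ≤ b) :
    E.R i b = 0 ∧ Tendsto (E.tEst i) (𝓝[<] b) (𝓝 0) := by
  have hmem : Ico (E.join i) b ∈ 𝓝[<] b := Ico_mem_nhdsLT hj
  have hz : Tendsto (fun t => b - t) (𝓝[<] b) (𝓝 0) := by
    have : Tendsto (fun t => b - t) (𝓝 b) (𝓝 (b - b)) := tendsto_const_nhds.sub tendsto_id
    rw [sub_self] at this
    exact this.mono_left nhdsWithin_le_nhds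
  have ht : Tendsto (E.tEst i) (𝓝[<] b) (𝓝 0) := by
    refine tendsto_of_tendsto_of_tendsto_of_le_of_le' tendsto_const_nhds hz ?_ ?_
    · filter_upwards [hmem] with t ht using
        (tEst_pos (rel_im_ne_zero_before hkin hlaw hstart hE hb ht)).le
    · filter_upwards [hmem] with t ht
      linarith [h t ht]
  refine ⟨tendsto_nhds_unique (tendsto_R hkin hb hj) ?_, ht⟩
  have hVt := ht.const_mul (E.V i)
  rw [mul_zero] at hVt
  refine tendsto_of_tendsto_of_tendsto_of_le_of_le' tendsto_const_nhds hVt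
    (Eventually.of_forall fun t => norm_nonneg _) ?_
  filter_upwards [hmem] with t ht using
    R_le_mul_tEst (rel_im_ne_zero_before hkin hlaw hstart hE hb ht)

/-- A period of disconnection before `b` belongs to a maximal one. -/
theorem exists_disconnectedPhase [Finite ι] (hdisc : E.DisconnectionBound) (hs : 0 ≤ s)
    (hsb : s < b) (h : ∀ u ∈ Ico s b, ¬ E.Connected u) :
    ∃ tm δ, E.DisconnectedPhase tm δ ∧ tm < b ∧ b ≤ tm + δ ∧
      ∀ i ∈ E.nodes tm, δ < E.tEst i tm := by
  -- Starting points of disconnected periods reaching up to `b`; the phase begins at their infimum.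
  set A := {s | 0 ≤ s ∧ s < b ∧ ∀ u ∈ Ico s b, ¬ E.Connected u} with hA
  have hbdd : BddBelow A := ⟨0, fun v hv => hv.1⟩
  have hAne : A.Nonempty := ⟨s, hs, hsb, h⟩
  set tm := sInf A with htm
  have htm0 : 0 ≤ tm := le_csInf hAne fun v hv => hv.1
  have htmb : tm < b := (csInf_le hbdd ⟨hs, hsb, h⟩).trans_lt hsb
  have hafter : ∀ u ∈ Ioo tm b, ¬ E.Connected u := by
    intro u hu
    obtain ⟨v, hv, hvu⟩ := exists_lt_of_csInf_lt hAne hu.1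
    exact hv.2.2 u ⟨hvu.le, hu.2⟩
  -- Connectedness at `tm` would persist on the static stretch just after it.
  have hat : ¬ E.Connected tm := by
    intro hc
    obtain ⟨r, htr, hstat⟩ := E.exists_static_right htm0
    obtain ⟨v, hv⟩ := exists_between (lt_min htr htmb)
    have hvb := hv.2.trans_le (min_le_right _ _)
    exact hafter v ⟨hv.1, hvb⟩ (hstat.connected hkin hlaw hstart
      ⟨hv.1.le, hv.2.trans_le (min_le_left _ _)⟩ (hE v (htm0.trans hv.1.le) hvb) hc)
  have hall : ∀ u ∈ Ico tm b, ¬ E.Connected u := fun u hu => by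
    rcases hu.1.eq_or_lt with rfl | hlt
    · exact hat
    · exact hafter u ⟨hlt, hu.2⟩
  have hloses : E.LosesReachability tm := by
    refine ⟨htm0, hat, or_iff_not_imp_left.2 fun hne => ?_⟩
    have hpos : 0 < tm := lt_of_le_of_ne htm0 (Ne.symm hne)
    obtain ⟨r, hr0, hrt, hstat⟩ := E.exists_static_left hpos
    -- On the static stretch before `tm`, one connected instant makes the rest up to `tm` connected;
    -- with none, the period would start before the infimum.
    by_cases hex : ∃ v ∈ Ico r tm, E.Connected v
    · obtain ⟨v, hv, hcv⟩ := hex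
      filter_upwards [Ioo_mem_nhdsLT hv.2] with t ht
      exact (hstat.mono hv.1).connected hkin hlaw hstart ⟨ht.1.le, ht.2⟩
        (hE t (hr0.trans (hv.1.trans ht.1.le)) (ht.2.trans htmb)) hcv
    · push Not at hex
      refine absurd (csInf_le hbdd (⟨hr0, hrt.trans htmb, fun u hu => ?_⟩ : r ∈ A)) (not_le.2 hrt)
      rcases lt_or_ge u tm with hlt | hge
      · exact hex u ⟨hu.1, hlt⟩
      · exact hall u ⟨hge, hu.2⟩
  obtain ⟨δ, hphase, hδ⟩ := hdisc tm (hE tm htm0 htmb) hloses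
  refine ⟨tm, δ, hphase, htmb, not_lt.1 fun hlt => ?_, hδ⟩
  exact hall (tm + δ) ⟨by linarith [hphase.2.1], hlt⟩ hphase.2.2.2

/-- Otherwise a disconnected phase ends at or after `b`. At its start, or on joining during it, `j`
predicted a time beyond its end, contradicting the arrival at `b`. -/
theorem exists_connected_of_arrival [Finite ι] (hdisc : E.DisconnectionBound)
    (hadd : E.DisconnectedAdditionCondition) (hb : E.InFlight j b) (hj : E.join j < b)
    (hR : E.R j b = 0) (hs : 0 ≤ s) (hsb : s < b) : ∃ u ∈ Ico s b, E.Connected u := by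
  by_contra! h
  obtain ⟨tm, δ, hphase, htm, hle, hδ⟩ :=
    exists_disconnectedPhase hkin hlaw hstart hE hdisc hs hsb h
  rcases le_or_gt (E.join j) tm with hjt | hjt
  · have h1 := hδ j (hb.mem_nodes hjt htm)
    have h2 := add_tEst_le_arrival hkin hlaw hstart hE hb hR ⟨hjt, htm⟩
    linarith
  · have h1 := hadd tm δ hphase j (hphase.1.1.trans_lt hjt)
      (hE _ (E.join_nonneg j) hj) ⟨hjt.le, hj.le.trans hle⟩
    have h2 := add_tEst_le_arrival hkin hlaw hstart hE hb hR ⟨le_rfl, hj⟩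
    linarith

/-- When one pursuer arrives, no other pursuer of the network predicts a later time. -/
theorem add_tEst_le_of_arrival [Finite ι] (hdisc : E.DisconnectionBound)
    (hadd : E.DisconnectedAdditionCondition) (hb : E.InFlight j b) (hj : E.join j < b)
    (hR : E.R j b = 0) (hib : E.InFlight i b) (ht : t ∈ Ico (E.join i) b) :
    t + E.tEst i t ≤ b := by
  by_contra! hlt
  have hb0 : 0 < b := (E.join_nonneg j).trans_lt hj
  obtain ⟨r, hr0, hrb, hstat⟩ := E.exists_static_left hb0
  -- Beyond `r'` the graph is static up to `b`, `j` has joined, and the late prediction of `i` has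
  -- already been made.
  set r' := max (max r t) (E.join j) with hr'
  have hrr' : r ≤ r' := (le_max_left _ _).trans (le_max_left _ _)
  have htr' : t ≤ r' := (le_max_right _ _).trans (le_max_left _ _)
  have hjr' : E.join j ≤ r' := le_max_right _ _
  obtain ⟨u, hu, hc⟩ := exists_connected_of_arrival hkin hlaw hstart hE hdisc hadd hb hj hR
    (hr0.trans hrr') (max_lt (max_lt hrb ht.2) hj)
  have hstat' : E.Static u b := hstat.mono (hrr'.trans hu.1)
  have hflight : ∀ k ∈ E.nodes u, E.InFlight k b := by
    intro k hk
    refine ⟨hk.1.trans hu.2.le, not_lt.1 fun hlt' => ?_⟩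
    obtain ⟨v, hv⟩ := WithTop.ne_top_iff_exists.1
      (LE.le.trans_lt hlt'.le (WithTop.coe_lt_top b)).ne
    rw [← hv] at hlt'
    have huv : u ≤ v := by have := hk.2.le; rw [← hv] at this; exact WithTop.coe_le_coe.1 this
    have : k ∈ E.nodes v := by
      rw [(hstat' v ⟨huv, WithTop.coe_lt_coe.1 hlt'⟩).1]; exact hk
    exact absurd this.2 (by rw [hv]; exact lt_irrefl _)
  obtain ⟨l, hl, hreach⟩ := hc
  have hiu : i ∈ E.nodes u := hib.mem_nodes (ht.1.trans (htr'.trans hu.1)) hu.2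
  have hju : j ∈ E.nodes u := hb.mem_nodes (hjr'.trans hu.1) hu.2
  have hlb : b < u + E.tEst l u := by
    have h1 := add_tEst_mono_before hkin hlaw hstart hE hib ht.1 (htr'.trans hu.1) hu.2
    linarith [hl.2 i hiu]
  -- Late nodes predict a time after `b` at some instant of `[u, b)`, and then at all later ones by
  -- monotonicity.
  set Late : ι → Prop := fun k => ∃ v ∈ Ico u b, b < v + E.tEst k v
  have hjl : ¬ Late j := fun ⟨v, hv, hbv⟩ => absurd
    (add_tEst_le_arrival hkin hlaw hstart hE hb hR ⟨hju.1.trans hv.1, hv.2⟩) (not_le.2 hbv)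
  have hll : Late l := ⟨u, ⟨le_rfl, hu.2⟩, hlb⟩
  -- A path from `j`, not late, to `l`, late, must enter the late nodes along some edge.
  obtain ⟨p, q, hpu, hqu, hpq, hp, v, hv, hq⟩ : ∃ p q, p ∈ E.nodes u ∧ q ∈ E.nodes u ∧
      (E.graph u).Adj p q ∧ ¬ Late p ∧ Late q := by
    have hpath := hreach.2 j hju
    revert hjl
    generalize j = k at hpath
    intro hk
    induction hpath using Relation.ReflTransGen.head_induction_on with
    | refl => exact absurd hll hk
    | @head a c hstep _ ih =>
      by_cases hcl : Late c
      · exact ⟨a, c, hstep.1, hstep.2.1, hstep.2.2, hk, hcl⟩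
      · exact ih hcl
  have hpv : v ∈ Ico (E.join p) b := ⟨hpu.1.trans hv.1, hv.2⟩
  have hp' : ∀ τ ∈ Ico u b, τ + E.tEst p τ ≤ b := fun τ hτ =>
    not_lt.1 fun h => hp ⟨τ, hτ, h⟩
  -- From `v` on, `q` has the larger estimate, so `p` misses; not being late, `p` must also hit at
  -- `b`.
  refine R_ne_zero_of_larger hkin hlaw hstart hE (hflight p hpu) hpv (fun τ hτ => ⟨q, ?_, ?_⟩)
    (arrives_of_add_tEst_le hkin hlaw hstart hE (hflight p hpu) (hpu.1.trans_lt hu.2)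
      fun τ hτ => ?_).1
  · rw [(hstat' τ ⟨hv.1.trans hτ.1.le, hτ.2⟩).2]; exact hpq
  · have h1 := hp' τ ⟨hv.1.trans hτ.1.le, hτ.2⟩
    have h2 := add_tEst_mono_before hkin hlaw hstart hE (hflight q hqu) (hqu.1.trans hv.1)
      hτ.1.le hτ.2
    linarith
  · rcases le_or_gt u τ with h | h
    · exact hp' τ ⟨h, hτ.2⟩
    · exact (add_tEst_mono_before hkin hlaw hstart hE (hflight p hpu) hτ.1 h.le hu.2).trans
        (hp' u ⟨le_rfl, hu.2⟩)

end Arrival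

end Engagement

/-! ### Simultaneous interception. -/

theorem mainTheorem8 {ι : Type*} [Finite ι] (E : Engagement ι)
    (hne : ∃ i, E.join i = 0)
    (hkin : E.Kinematics)
    (hstart : E.AdmissibleStart)
    (hlaw : E.FollowsGuidanceLaw)
    (hdisc : E.DisconnectionBound)
    (hrem : E.RemovalCondition)
    (hconn : E.ConnectedAdditionCondition)
    (hadd : E.DisconnectedAdditionCondition) :
    E.SimultaneousInterception := by
  obtain ⟨tf, ⟨j, hj, hR⟩, hE⟩ := Engagement.exists_first_arrival hkin
    (Engagement.exists_not_engaged hne hkin hlaw hstart hrem)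
  have hjtf : E.join j < tf := lt_of_le_of_ne hj.1 fun h => by
    have := (hstart j).1
    rw [h, hR] at this
    exact lt_irrefl _ this
  refine ⟨tf, (E.join_nonneg j).trans_lt hjtf, fun t h0 ht i hi hx => ?_, ⟨j, hjtf, hj.2⟩,
    fun i hi hleave => ?_⟩
  · exact (Engagement.R_pos (hE t h0 ht) hi).ne' (Engagement.R_eq_zero_iff.2 hx)
  · have hfl : E.InFlight i tf := ⟨hi.le, hleave⟩
    obtain ⟨h1, h2⟩ := Engagement.arrives_of_add_tEst_le hkin hlaw hstart hE hfl hi fun t ht =>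
      Engagement.add_tEst_le_of_arrival hkin hlaw hstart hE hdisc hadd hj hjtf hR hfl ht
    exact ⟨Engagement.R_eq_zero_iff.1 h1, h2⟩
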